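/- Let $F_3$ be the free group with basis $\{a_1,a_2,a_3\}$, let $\mathrm{Out}(F_3)=\mathrm{Aut}(F_3)/\mathrm{Inn}(F_3)$, and for $i\ne j$ let $\lambda_{ij}\in\mathrm{Aut}(F_3)$ be the (left) Nielsen transformation with $\lambda_{ij}(a_i)=a_ja_i$ and $\lambda_{ij}(a_k)=a_k$ for $k\neq i$; write $[\lambda_{ij}]$ for its class in $\mathrm{Out}(F_3)$. For every integer $k\ge 1$ there exist a subgroup $H_k\subset\mathrm{Out}(F_3)$ of finite index and a surjective homomorphism $\pi_k:H_k\to F_k$ onto the free group of rank $k$ such that the image of $\pi_k$ is generated by the elements $\pi_k(h)$, where $h$ ranges over the elements of $H_k$ of the form $(g[\lambda_{ij}]g^{-1})^n$ with $i\neq j$, $g\in\mathrm{Out}(F_3)$ and $n\in\mathbb Z$. -/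

import Mathlib

/-- The subgroup `Inn(G)` of inner automorphisms of `G`. -/
def Inn (G : Type*) [Group G] : Subgroup (MulAut G) :=
  (MulAut.conj : G →* MulAut G).range

instance Inn.normal (G : Type*) [Group G] : (Inn G).Normal where
  conj_mem := by
    rintro _ ⟨x, rfl⟩ φ
    refine ⟨φ x, ?_⟩
    ext y
    simp [MulAut.mul_apply, MulAut.conj_apply]

/-- The outer automorphism group `Out(G) = Aut(G) / Inn(G)`. -/
abbrev Out (G : Type*) [Group G] : Type _ :=
  MulAut G ⧸ Inn G

/-- The endomorphism of the free group on `α` sending the basis element `a i` to `u * a i` and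
fixing the other basis elements. -/
def leftMulEnd {α : Type*} [DecidableEq α] (i : α) (u : FreeGroup α) :
    FreeGroup α →* FreeGroup α :=
  FreeGroup.lift fun k => if k = i then u * FreeGroup.of i else FreeGroup.of k

/-- The left Nielsen transformation `λᵢⱼ` (for `i ≠ j`): the automorphism of the free group on `α`
with `a i ↦ a j * a i` and `a k ↦ a k` for `k ≠ i`. -/
def leftNielsen {α : Type*} [DecidableEq α] (i j : α) (hij : i ≠ j) : MulAut (FreeGroup α) :=
  MonoidHom.toMulEquiv (leftMulEnd i (FreeGroup.of j)) (leftMulEnd i (FreeGroup.of j)⁻¹)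
    (by
      ext k
      by_cases hk : k = i <;> simp [leftMulEnd, hk, hij.symm])
    (by
      ext k
      by_cases hk : k = i <;> simp [leftMulEnd, hk, hij.symm])

theorem leftNielsen_of {α : Type*} [DecidableEq α] (i j : α) (hij : i ≠ j) (k : α) :
    leftNielsen i j hij (FreeGroup.of k) =
      if k = i then FreeGroup.of j * FreeGroup.of i else FreeGroup.of k := by
  simp [leftNielsen, leftMulEnd]

/-- The elements of `Out(F)`, for `F` the free group on `α`, that are powers of conjugates of (the
classes of) the left Nielsen transformations `λᵢⱼ`. -/
def nielsenConjPowers (α : Type*) [DecidableEq α] : Set (Out (FreeGroup α)) :=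
  {x | ∃ (i j : α) (hij : i ≠ j) (g : Out (FreeGroup α)) (n : ℤ),
    x = (g * (QuotientGroup.mk (leftNielsen i j hij) : Out (FreeGroup α)) * g⁻¹) ^ n}

/-! The automorphisms of F₃ preserving the character a₀ ↦ -1, a₁, a₂ ↦ 1 form a subgroup of finite
index. It acts on the rank-two anti-invariant homology of the corresponding double cover, which
gives `twistedRep` into GL₂(ℤ). There λ₂₁² and λ₁₂² become Sanov's matrices, which freely generate a
subgroup of finite index (`sanov_injective`, `finiteIndex_range_sanov`).

In the free group on x, y, a finite-index subgroup U maps onto F_k with yⁱxy⁻ⁱ ↦ aᵢ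
(`cyclicShift_conj`). Since x corresponds to λ₂₁², these elements lift to conjugates of λ₂₁².
Pulling U back along `twistedRep` gives a finite-index P with a map to F_k. Inner automorphisms act
by ±1 and F_k is torsion-free, so this map descends to the image of P in Out(F₃). -/

section Sanov

/-! ### Sanov's theorem: freeness and finite index. -/

/-- The matrices `[[1, 2], [0, 1]]` and `[[1, 0], [2, 1]]` of Sanov's theorem. -/
def sanovGen : Fin 2 → GL (Fin 2) ℤ :=
  ![⟨!![1, 2; 0, 1], !![1, -2; 0, 1], by simp [Matrix.one_fin_two], by simp [Matrix.one_fin_two]⟩,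
    ⟨!![1, 0; 2, 1], !![1, 0; -2, 1], by simp [Matrix.one_fin_two], by simp [Matrix.one_fin_two]⟩]

theorem coe_sanovGen_zero : (sanovGen 0 : Matrix (Fin 2) (Fin 2) ℤ) = !![1, 2; 0, 1] := rfl

theorem coe_sanovGen_one : (sanovGen 1 : Matrix (Fin 2) (Fin 2) ℤ) = !![1, 0; 2, 1] := rfl

theorem coe_sanovGen_zero_inv :
    ((sanovGen 0)⁻¹ : GL (Fin 2) ℤ).val = !![1, -2; 0, 1] := rfl

theorem coe_sanovGen_one_inv :
    ((sanovGen 1)⁻¹ : GL (Fin 2) ℤ).val = !![1, 0; -2, 1] := rfl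

/-- The homomorphism from the free group of rank two to `GL₂(ℤ)` given by the Sanov matrices. -/
def sanov : FreeGroup (Fin 2) →* GL (Fin 2) ℤ := FreeGroup.lift sanovGen

theorem GL_fin_two_col_ne_zero (g : GL (Fin 2) ℤ) : g.val 0 0 ≠ 0 ∨ g.val 1 0 ≠ 0 := by
  by_contra! h
  have := (Matrix.isUnits_det_units g)
  rw [Matrix.det_fin_two, h.1, h.2] at this
  simp at this

/-- This and the next three lemmas are the ping-pong moves on a column with entries p and q; the
second generator uses them with the entries swapped. -/
theorem abs_le_abs_add_two_mul {p q : ℤ} (h : ¬(|q| < |p| ∧ p * q < 0)) :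
    |q| ≤ |p + 2 * q| ∧ 0 ≤ (p + 2 * q) * q := by
  rcases lt_trichotomy q 0 with hq | rfl | hq
  · have : p ≤ -q := by
      by_contra! hp
      exact h ⟨by grind, mul_neg_of_pos_of_neg (by linarith) hq⟩
    exact ⟨by grind, mul_nonneg_of_nonpos_of_nonpos (by linarith) hq.le⟩
  · simp
  · have : -q ≤ p := by
      by_contra! hp
      exact h ⟨by grind, mul_neg_of_neg_of_pos (by linarith) hq⟩
    exact ⟨by grind, mul_nonneg (by linarith) hq.le⟩

theorem abs_lt_abs_add_two_mul {p q : ℤ} (hpq : p ≠ 0 ∨ q ≠ 0)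
    (h : ¬(|q| ≤ |p| ∧ p * q < 0)) :
    |q| < |p + 2 * q| ∧ 0 ≤ (p + 2 * q) * q := by
  rcases lt_trichotomy q 0 with hq | rfl | hq
  · have : p < -q := by
      by_contra! hp
      exact h ⟨by grind, mul_neg_of_pos_of_neg (by linarith) hq⟩
    exact ⟨by grind, mul_nonneg_of_nonpos_of_nonpos (by linarith) hq.le⟩
  · simpa using hpq
  · have : -q < p := by
      by_contra! hp
      exact h ⟨by grind, mul_neg_of_neg_of_pos (by linarith) hq⟩
    exact ⟨by grind, mul_nonneg (by linarith) hq.le⟩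

theorem abs_lt_abs_sub_two_mul {p q : ℤ} (hpq : p ≠ 0 ∨ q ≠ 0)
    (h : ¬(|q| ≤ |p| ∧ 0 ≤ p * q)) :
    |q| < |p - 2 * q| ∧ (p - 2 * q) * q < 0 := by
  rcases lt_trichotomy q 0 with hq | rfl | hq
  · have : q < p := by
      by_contra! hp
      exact h ⟨by grind, mul_nonneg_of_nonpos_of_nonpos (by linarith) hq.le⟩
    exact ⟨by grind, mul_neg_of_pos_of_neg (by linarith) hq⟩
  · simp at h
  · have : p < q := by
      by_contra! hp
      exact h ⟨by grind, mul_nonneg (by linarith) hq.le⟩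
    exact ⟨by grind, mul_neg_of_neg_of_pos (by linarith) hq⟩

theorem abs_le_abs_sub_two_mul {p q : ℤ} (hpq : p ≠ 0 ∨ q ≠ 0)
    (h : ¬(|q| < |p| ∧ 0 ≤ p * q)) :
    |q| ≤ |p - 2 * q| ∧ (p - 2 * q) * q < 0 := by
  rcases lt_trichotomy q 0 with hq | rfl | hq
  · have : q ≤ p := by
      by_contra! hp
      exact h ⟨by grind, mul_nonneg_of_nonpos_of_nonpos (by linarith) hq.le⟩
    exact ⟨by grind, mul_neg_of_pos_of_neg (by linarith) hq⟩
  · simp at h hpq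
    contradiction
  · have : p ≤ q := by
      by_contra! hp
      exact h ⟨by grind, mul_nonneg (by linarith) hq.le⟩
    exact ⟨by grind, mul_neg_of_neg_of_pos (by linarith) hq⟩

theorem sanov_injective : Function.Injective sanov := by
  -- GL₂(ℤ) acts on itself by left multiplication and the regions depend on the first column only.
  -- Ties in absolute value go to the first region if the product is nonnegative and to the last if
  -- it is negative, which keeps the four regions disjoint.
  refine FreeGroup.injective_lift_of_ping_pong (α := GL (Fin 2) ℤ) sanovGen
    ![{g | |g.val 1 0| ≤ |g.val 0 0| ∧ 0 ≤ g.val 0 0 * g.val 1 0},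
      {g | |g.val 0 0| < |g.val 1 0| ∧ 0 ≤ g.val 0 0 * g.val 1 0}]
    ![{g | |g.val 1 0| < |g.val 0 0| ∧ g.val 0 0 * g.val 1 0 < 0},
      {g | |g.val 0 0| ≤ |g.val 1 0| ∧ g.val 0 0 * g.val 1 0 < 0}] ?_ ?_ ?_ ?_ ?_ ?_
  · intro i
    fin_cases i
    · exact ⟨1, by simp⟩
    · exact ⟨⟨!![0, 1; 1, 0], !![0, 1; 1, 0], by simp [Matrix.one_fin_two],
        by simp [Matrix.one_fin_two]⟩, by simp⟩
  · intro i j hij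
    fin_cases i <;> fin_cases j <;> simp [Function.onFun, Set.disjoint_left] at hij ⊢ <;> grind
  · intro i j hij
    fin_cases i <;> fin_cases j <;> simp [Function.onFun, Set.disjoint_left] at hij ⊢ <;> grind
  · intro i j
    fin_cases i <;> fin_cases j <;> simp [Set.disjoint_left] <;> grind
  · rintro i _ ⟨g, hg, rfl⟩
    have hne := GL_fin_two_col_ne_zero g
    fin_cases i
    · simpa [coe_sanovGen_zero, Matrix.mul_apply, Fin.sum_univ_two] using
        abs_le_abs_add_two_mul hg
    · simpa [coe_sanovGen_one, Matrix.mul_apply, Fin.sum_univ_two, add_comm, mul_comm] using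
        abs_lt_abs_add_two_mul hne.symm (by simpa [mul_comm] using hg)
  · rintro i _ ⟨g, hg, rfl⟩
    have hne := GL_fin_two_col_ne_zero g
    have h0 : (sanovGen⁻¹ 0).val = !![1, -2; 0, 1] := rfl
    have h1 : (sanovGen⁻¹ 1).val = !![1, 0; -2, 1] := rfl
    fin_cases i
    · simpa [h0, Matrix.mul_apply, Fin.sum_univ_two, -Pi.inv_apply, ← sub_eq_add_neg] using
        abs_lt_abs_sub_two_mul hne hg
    · simpa [h1, Matrix.mul_apply, Fin.sum_univ_two, -Pi.inv_apply, sub_eq_add_neg, add_comm,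
        mul_comm] using abs_le_abs_sub_two_mul hne.symm (by simpa [mul_comm] using hg)

theorem sanovGen_mem_range (i : Fin 2) : sanovGen i ∈ sanov.range :=
  ⟨FreeGroup.of i, FreeGroup.lift_apply_of⟩

theorem coe_sanovGen_zero_zpow (m : ℤ) :
    (sanovGen 0 ^ m : GL (Fin 2) ℤ).val = !![1, 2 * m; 0, 1] := by
  induction m with
  | zero => simp [Matrix.one_fin_two]
  | succ n ih =>
    rw [_root_.zpow_add_one, Units.val_mul, ih, coe_sanovGen_zero]
    simp [mul_add, add_comm]
  | pred n ih =>
    rw [_root_.zpow_sub_one, Units.val_mul, ih, coe_sanovGen_zero_inv]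
    simp
    ring

/-- Parity rules out |a| = |c|, so a suitable shift of the larger entry by twice the smaller
strictly shrinks it. -/
theorem natAbs_add_or_sub_two_mul_lt {a c : ℤ} (ha : ¬ 2 ∣ a) (hc : 2 ∣ c) (hc0 : c ≠ 0) :
    (a + 2 * c).natAbs < a.natAbs ∨ (a - 2 * c).natAbs < a.natAbs ∨
      (c + 2 * a).natAbs < c.natAbs ∨ (c - 2 * a).natAbs < c.natAbs := by
  rcases le_total 0 a with h1 | h1 <;> rcases le_total 0 c with h2 | h2
  · have : (a - 2 * c).natAbs < a.natAbs ∨ (c - 2 * a).natAbs < c.natAbs := by omega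
    tauto
  · have : (a + 2 * c).natAbs < a.natAbs ∨ (c + 2 * a).natAbs < c.natAbs := by omega
    tauto
  · have : (a + 2 * c).natAbs < a.natAbs ∨ (c + 2 * a).natAbs < c.natAbs := by omega
    tauto
  · have : (a - 2 * c).natAbs < a.natAbs ∨ (c - 2 * a).natAbs < c.natAbs := by omega
    tauto

/-- Euclidean descent on the first column; multiplication by the generators preserves the
congruences. -/
theorem mem_range_sanov_of_congr (g : GL (Fin 2) ℤ) (h00 : 4 ∣ g.val 0 0 - 1)
    (h01 : 2 ∣ g.val 0 1) (h10 : 2 ∣ g.val 1 0) (h11 : 4 ∣ g.val 1 1 - 1) :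
    g ∈ sanov.range := by
  induction hn : (g.val 0 0).natAbs + (g.val 1 0).natAbs using Nat.strong_induction_on
    generalizing g with
  | _ n ih =>
  have step : ∀ s ∈ sanov.range, 4 ∣ (s * g).val 0 0 - 1 → 2 ∣ (s * g).val 0 1 →
      2 ∣ (s * g).val 1 0 → 4 ∣ (s * g).val 1 1 - 1 →
      ((s * g).val 0 0).natAbs + ((s * g).val 1 0).natAbs < n → g ∈ sanov.range :=
    fun s hs h1 h2 h3 h4 h5 => (sanov.range.mul_mem_cancel_left hs).1 (ih _ h5 _ h1 h2 h3 h4 rfl)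
  have hA := step _ (sanovGen_mem_range 0)
  have hA' := step _ (inv_mem (sanovGen_mem_range 0))
  have hB := step _ (sanovGen_mem_range 1)
  have hB' := step _ (inv_mem (sanovGen_mem_range 1))
  rw [Units.val_mul, coe_sanovGen_zero] at hA
  rw [Units.val_mul, coe_sanovGen_zero_inv] at hA'
  rw [Units.val_mul, coe_sanovGen_one] at hB
  rw [Units.val_mul, coe_sanovGen_one_inv] at hB'
  simp only [Matrix.mul_apply, Fin.sum_univ_two, Matrix.of_apply, Matrix.cons_val_zero,
    Matrix.cons_val_one, Matrix.cons_val', Matrix.cons_val_fin_one] at hA hA' hB hB'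
  by_cases hc : g.val 1 0 = 0
  · have hdet := Int.isUnit_iff.1 (Matrix.isUnits_det_units g)
    rw [Matrix.det_fin_two, hc, mul_zero, sub_zero] at hdet
    have hunit : IsUnit (g.val 0 0 * g.val 1 1) := Int.isUnit_iff.2 hdet
    have ha := Int.isUnit_iff.1 (isUnit_of_mul_isUnit_left hunit)
    have hd := Int.isUnit_iff.1 (isUnit_of_mul_isUnit_right hunit)
    -- The condition modulo 4 excludes the sign -1.
    have ha : g.val 0 0 = 1 := by omega
    have hd : g.val 1 1 = 1 := by omega
    obtain ⟨m, hm⟩ := h01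
    have hg : g = sanovGen 0 ^ m := by
      ext i j
      rw [coe_sanovGen_zero_zpow]
      fin_cases i <;> fin_cases j <;> simp [ha, hc, hd, hm]
    exact hg ▸ zpow_mem (sanovGen_mem_range 0) m
  · have hred : (g.val 0 0 + 2 * g.val 1 0).natAbs < (g.val 0 0).natAbs ∨
        (g.val 0 0 - 2 * g.val 1 0).natAbs < (g.val 0 0).natAbs ∨
        (g.val 1 0 + 2 * g.val 0 0).natAbs < (g.val 1 0).natAbs ∨
        (g.val 1 0 - 2 * g.val 0 0).natAbs < (g.val 1 0).natAbs :=
      natAbs_add_or_sub_two_mul_lt (by omega) h10 hc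
    clear ih step
    rcases hred with h | h | h | h
    · clear hA' hB hB'
      refine hA ?_ ?_ ?_ ?_ ?_ <;> omega
    · clear hA hB hB'
      refine hA' ?_ ?_ ?_ ?_ ?_ <;> omega
    · clear hA hA' hB'
      refine hB ?_ ?_ ?_ ?_ ?_ <;> omega
    · clear hA hA' hB
      refine hB' ?_ ?_ ?_ ?_ ?_ <;> omega

theorem finiteIndex_range_sanov : sanov.range.FiniteIndex := by
  have := Subgroup.finiteIndex_ker
    (Matrix.GeneralLinearGroup.map (n := Fin 2) (Int.castRingHom (ZMod 4)))
  refine Subgroup.finiteIndex_of_le (H := (Matrix.GeneralLinearGroup.map (n := Fin 2)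
    (Int.castRingHom (ZMod 4))).ker) fun g hg => ?_
  have key : ∀ i j, ((g.val i j : ℤ) : ZMod 4) = (1 : Matrix (Fin 2) (Fin 2) (ZMod 4)) i j := by
    intro i j
    have := congrArg (fun m : GL (Fin 2) (ZMod 4) => m.val i j) (MonoidHom.mem_ker.1 hg)
    simpa using this
  have h00 := key 0 0
  have h01 := key 0 1
  have h10 := key 1 0
  have h11 := key 1 1
  simp only [Matrix.one_apply_eq, ne_eq, zero_ne_one, one_ne_zero, not_false_eq_true,
    Matrix.one_apply_ne] at h00 h01 h10 h11
  have aux : ∀ a : ℤ, (a : ZMod 4) = 1 → 4 ∣ a - 1 := fun a ha => by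
    rw [← sub_eq_zero] at ha
    exact (ZMod.intCast_zmod_eq_zero_iff_dvd _ 4).1 (by exact_mod_cast ha)
  have aux' : ∀ a : ℤ, (a : ZMod 4) = 0 → 2 ∣ a := fun a ha =>
    Dvd.dvd.trans (by norm_num) ((ZMod.intCast_zmod_eq_zero_iff_dvd _ 4).1 ha)
  exact mem_range_sanov_of_congr g (aux _ h00) (aux' _ h01) (aux' _ h10) (aux _ h11)

end Sanov

/-! ### The twisted homology representation. -/

section TwistedRepresentation

/-- The character of the free group on `a₀, a₁, a₂` with `a₀ ↦ -1` and `a₁, a₂ ↦ 1`. -/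
def signChar : FreeGroup (Fin 3) →* ℤˣ := FreeGroup.lift ![-1, 1, 1]

/-- The affine action on `ℤ²` for which `a₀` acts as `-1` and `a₁, a₂` translate by the standard
basis vectors. -/
def affineAction : FreeGroup (Fin 3) →* Equiv.Perm (Fin 2 → ℤ) :=
  FreeGroup.lift ![Equiv.neg _, Equiv.addRight (Pi.single 0 1), Equiv.addRight (Pi.single 1 1)]

/-- The crossed homomorphism `F₃ → ℤ²` (for the action of `F₃` through `signChar`) with `a₀ ↦ 0`
and `a₁, a₂` sent to the standard basis vectors. -/
def crossedHom (x : FreeGroup (Fin 3)) : Fin 2 → ℤ := affineAction x 0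

theorem affineAction_apply (x : FreeGroup (Fin 3)) (z : Fin 2 → ℤ) :
    affineAction x z = (signChar x : ℤ) • z + crossedHom x := by
  induction x using FreeGroup.induction_on generalizing z with
  | C1 => simp [crossedHom]
  | of i => fin_cases i <;> simp [crossedHom, affineAction, signChar]
  | inv_of i ih =>
    fin_cases i <;> simp [crossedHom, affineAction, signChar, Equiv.Perm.inv_def]
  | mul x y ihx ihy =>
    rw [map_mul, Equiv.Perm.mul_apply, ihy, ihx, crossedHom, map_mul,
      crossedHom.eq_1 (x * y), map_mul, Equiv.Perm.mul_apply, ihx (affineAction y 0)]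
    simp [mul_smul, smul_add, add_assoc]

theorem crossedHom_mul (x y : FreeGroup (Fin 3)) :
    crossedHom (x * y) = (signChar x : ℤ) • crossedHom y + crossedHom x := by
  rw [← affineAction_apply, crossedHom, map_mul, Equiv.Perm.mul_apply, crossedHom]

theorem crossedHom_one : crossedHom 1 = 0 := by simp [crossedHom]

theorem crossedHom_of_zero : crossedHom (FreeGroup.of 0) = 0 := by simp [crossedHom, affineAction]

theorem crossedHom_of_succ (j : Fin 2) :
    crossedHom (FreeGroup.of j.succ) = Pi.single j 1 := by
  fin_cases j <;> simp [crossedHom, affineAction]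

theorem signChar_of_zero : signChar (FreeGroup.of 0) = -1 := by simp [signChar]

theorem signChar_of_succ (j : Fin 2) : signChar (FreeGroup.of j.succ) = 1 := by
  fin_cases j <;> simp [signChar]

theorem crossedHom_inv (x : FreeGroup (Fin 3)) :
    crossedHom x⁻¹ = -((signChar x : ℤ) • crossedHom x) := by
  have h := crossedHom_mul x⁻¹ x
  rw [inv_mul_cancel, crossedHom_one, map_inv, Int.units_inv_eq_self] at h
  exact (neg_eq_of_add_eq_zero_right h.symm).symm

theorem crossedHom_conj (x y : FreeGroup (Fin 3)) (hy : signChar y = 1) :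
    crossedHom (x * y * x⁻¹) = (signChar x : ℤ) • crossedHom y := by
  rw [crossedHom_mul, crossedHom_mul, crossedHom_inv, map_mul, hy]
  rcases Int.units_eq_one_or (signChar x) with h | h <;> simp [h]

/-- The automorphisms of `F₃` that preserve `signChar`. -/
def signStabilizer : Subgroup (MulAut (FreeGroup (Fin 3))) where
  carrier := {φ | ∀ x, signChar (φ x) = signChar x}
  one_mem' := fun _ => rfl
  mul_mem' := fun {φ ψ} hφ hψ x => by rw [MulAut.mul_apply, hφ, hψ]
  inv_mem' := fun {φ} hφ x => by rw [← hφ, MulAut.apply_inv_self]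

instance : Finite (FreeGroup (Fin 3) →* ℤˣ) := Finite.of_equiv _ FreeGroup.lift

/-- The action of `Aut(G)` on the homomorphisms from `G` to `M` by precomposition. -/
def precompPerm (G M : Type*) [Group G] [Monoid M] : MulAut G →* Equiv.Perm (G →* M) where
  toFun φ :=
    { toFun := fun f => f.comp (φ⁻¹ : MulAut G).toMonoidHom
      invFun := fun f => f.comp φ.toMonoidHom
      left_inv := fun f => by ext x; simp
      right_inv := fun f => by ext x; simp }
  map_one' := rfl
  map_mul' _ _ := by ext; simp

instance finiteIndex_signStabilizer : signStabilizer.FiniteIndex := by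
  refine Subgroup.finiteIndex_of_le (H := (precompPerm (FreeGroup (Fin 3)) ℤˣ).ker) fun φ hφ x => ?_
  -- The inverse permutation is precomposition with φ itself.
  have h := congrArg (fun e => e.symm signChar x) (MonoidHom.mem_ker.1 hφ)
  exact h

theorem conj_mem_signStabilizer (x : FreeGroup (Fin 3)) : MulAut.conj x ∈ signStabilizer := by
  intro y
  rw [MulAut.conj_apply, map_mul, map_mul, map_inv, mul_right_comm, mul_inv_cancel, one_mul]

/-- The matrix of an automorphism of `F₃` on the twisted homology `ℤ²`. -/
def twistedMatrix (φ : MulAut (FreeGroup (Fin 3))) : Matrix (Fin 2) (Fin 2) ℤ :=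
  Matrix.of fun i j => crossedHom (φ (FreeGroup.of j.succ)) i

/-- Both sides are crossed homomorphisms for `signChar`, so agreement on the basis suffices. The
last term is principal; the factor 2 avoids halving, since 1 - `signChar` is 2 at a₀. -/
theorem two_smul_crossedHom_apply (φ : signStabilizer) (x : FreeGroup (Fin 3)) :
    (2 : ℤ) • crossedHom (φ.1 x) = (2 : ℤ) • (twistedMatrix φ).mulVec (crossedHom x) +
      (1 - (signChar x : ℤ)) • crossedHom (φ.1 (FreeGroup.of 0)) := by
  have hof : ∀ i, (2 : ℤ) • crossedHom (φ.1 (FreeGroup.of i)) =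
      (2 : ℤ) • (twistedMatrix φ).mulVec (crossedHom (FreeGroup.of i)) +
      (1 - (signChar (FreeGroup.of i) : ℤ)) • crossedHom (φ.1 (FreeGroup.of 0)) := by
    intro i
    cases i using Fin.cases with
    | zero => rw [crossedHom_of_zero, signChar_of_zero]; simp
    | succ j => rw [crossedHom_of_succ, signChar_of_succ]; ext; simp [twistedMatrix]
  induction x using FreeGroup.induction_on with
  | C1 => simp [crossedHom_one]
  | of i => exact hof i
  | inv_of i ih =>
    rw [map_inv, crossedHom_inv, crossedHom_inv, φ.2, map_inv, Int.units_inv_eq_self,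
      Matrix.mulVec_neg, Matrix.mulVec_smul]
    rcases Int.units_eq_one_or (signChar (FreeGroup.of i)) with h | h
    · simpa only [h, Units.val_one, one_smul, smul_neg, Matrix.mulVec_neg, sub_self, zero_smul,
        add_zero, neg_inj] using hof i
    · simpa only [h, Units.val_neg, Units.val_one, neg_smul, one_smul, neg_neg] using hof i
  | mul x y ihx ihy =>
    rw [map_mul, crossedHom_mul, crossedHom_mul, φ.2, map_mul, Matrix.mulVec_add,
      Matrix.mulVec_smul, smul_add, smul_comm, ihx, ihy]
    push_cast
    module

theorem crossedHom_apply (φ : signStabilizer) (x : FreeGroup (Fin 3)) (hx : signChar x = 1) :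
    crossedHom (φ.1 x) = (twistedMatrix φ).mulVec (crossedHom x) := by
  have h := two_smul_crossedHom_apply φ x
  rw [hx, Units.val_one, sub_self, zero_smul, add_zero] at h
  exact smul_right_injective _ two_ne_zero h

/-- The action of `signStabilizer` on the twisted homology `ℤ²`. -/
def twistedRep : signStabilizer →* GL (Fin 2) ℤ :=
  MonoidHom.toHomUnits
    { toFun := fun φ => twistedMatrix φ
      map_one' := by
        ext i j
        simp [twistedMatrix, crossedHom_of_succ, Matrix.one_apply, Pi.single_apply]
      map_mul' := fun φ ψ => by
        ext i j
        have h := crossedHom_apply φ (ψ.1 (FreeGroup.of j.succ))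
          ((ψ.2 _).trans (signChar_of_succ j))
        exact congrFun h i }

theorem coe_twistedRep (φ : signStabilizer) : (twistedRep φ).val = twistedMatrix φ := rfl

theorem twistedRep_conj_sq (x : FreeGroup (Fin 3)) :
    twistedRep ⟨MulAut.conj x, conj_mem_signStabilizer x⟩ ^ 2 = 1 := by
  have h : twistedMatrix (MulAut.conj x) = (signChar x : ℤ) • (1 : Matrix (Fin 2) (Fin 2) ℤ) := by
    ext i j
    simp [twistedMatrix, MulAut.conj_apply, crossedHom_conj _ _ (signChar_of_succ j),
      crossedHom_of_succ, Matrix.one_apply, Pi.single_apply]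
  ext1
  rw [Units.val_pow_eq_pow_val, coe_twistedRep, h, smul_pow, ← Units.val_pow_eq_pow_val,
    Int.units_sq]
  simp

theorem leftNielsen_mem_signStabilizer (i j : Fin 3) (hij : i ≠ j) (hj : j ≠ 0) :
    leftNielsen i j hij ∈ signStabilizer := by
  obtain ⟨j, rfl⟩ := Fin.exists_succ_eq.2 hj
  have h : signChar.comp (leftNielsen i j.succ hij).toMonoidHom = signChar := by
    ext k
    by_cases hk : k = i <;> simp [leftNielsen_of, hk, signChar_of_succ]
  exact fun x => DFunLike.congr_fun h x

/-- The transvections of `F₃` fixing `a₀`, with the indices matching those of `sanovGen`. -/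
def nielsenGen : Fin 2 → signStabilizer :=
  ![⟨leftNielsen 2 1 (by decide), leftNielsen_mem_signStabilizer _ _ _ (by decide)⟩,
    ⟨leftNielsen 1 2 (by decide), leftNielsen_mem_signStabilizer _ _ _ (by decide)⟩]

theorem twistedRep_nielsenGen_sq (i : Fin 2) : twistedRep (nielsenGen i ^ 2) = sanovGen i := by
  have h1 := crossedHom_of_succ 0
  have h2 := crossedHom_of_succ 1
  have h3 := signChar_of_succ 0
  have h4 := signChar_of_succ 1
  simp only [Fin.succ_zero_eq_one, Fin.succ_one_eq_two] at h1 h2 h3 h4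
  fin_cases i <;> rw [map_pow] <;> ext1 <;>
    rw [Units.val_pow_eq_pow_val, coe_twistedRep, sq, ← Matrix.ext_iff] <;>
    simp [Fin.forall_fin_two, Matrix.mul_apply, Fin.sum_univ_two, nielsenGen, twistedMatrix,
      leftNielsen_of, crossedHom_mul, coe_sanovGen_zero, coe_sanovGen_one, h1, h2, h3, h4]

end TwistedRepresentation

/-! ### Transporting finite index and homomorphisms. -/

section Descent

variable {G G' A L N Q : Type*} [Group G] [Group G'] [Group A] [Group L] [Group N] [Group Q]

theorem Subgroup.finiteIndex_map_of_range (f : G →* G') [f.range.FiniteIndex]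
    (H : Subgroup G) [H.FiniteIndex] : (H.map f).FiniteIndex := by
  have := Subgroup.finiteIndex_of_le (le_sup_left : H ≤ H ⊔ f.ker)
  refine ⟨?_⟩
  rw [Subgroup.index_map]
  exact mul_ne_zero this.index_ne_zero Subgroup.FiniteIndex.index_ne_zero

theorem Subgroup.finiteIndex_comap (f : G →* G') (H : Subgroup G') [H.FiniteIndex] :
    (H.comap f).FiniteIndex :=
  ⟨by rw [Subgroup.index_comap]; exact H.isFiniteRelIndex_of_finiteIndex.relIndex_ne_zero⟩

/-- The homomorphism to the left factor of a semidirect product, on the subgroup that is trivial in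
the right factor. -/
def SemidirectProduct.leftOnKer {φ : Q →* MulAut N} (ω : A →* N ⋊[φ] Q) :
    (SemidirectProduct.rightHom.comp ω).ker →* N :=
  MonoidHom.mk' (fun x => (ω x).left) fun x y => by
    have hx : (ω x).right = 1 := x.2
    simp [hx]

/-- A homomorphism on `U ≤ A` extends along `ρ : L → G'` through an injection `s : A → G'`. -/
noncomputable def pullbackAlong {U : Subgroup A} (t : U →* N) (s : A →* G')
    (hs : Function.Injective s) (ρ : L →* G') : (U.map s).comap ρ →* N :=
  t.comp ((U.equivMapOfInjective s hs).symm.toMonoidHom.comp (ρ.subgroupComap (U.map s)))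

theorem pullbackAlong_apply {U : Subgroup A} (t : U →* N) (s : A →* G')
    (hs : Function.Injective s) (ρ : L →* G') (x : (U.map s).comap ρ) (u : U)
    (h : ρ x = s u) : pullbackAlong t s hs ρ x = t u := by
  have : ρ.subgroupComap (U.map s) x = U.equivMapOfInjective s hs u := Subtype.ext h
  simp [pullbackAlong, this]

theorem exists_descent (f : G →* G') (P : Subgroup G) (q : P →* N)
    (h : ∀ x : P, f x = 1 → q x = 1) :
    ∃ r : P.map f →* N, ∀ x : P, r (f.subgroupMap P x) = q x := by
  have hsurj := f.subgroupMap_surjective P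
  refine ⟨(f.subgroupMap P).liftOfSurjective hsurj ⟨q, fun x hx => h x ?_⟩, fun x => ?_⟩
  · exact congrArg Subtype.val (MonoidHom.mem_ker.1 hx)
  · exact MonoidHom.liftOfRightInverse_comp_apply _ _ _ _ x

end Descent

/-! ### A virtual surjection from F₂ onto a free group of any positive rank. -/

section CyclicShift

/-- The permutation action on the basis of a free group, by group automorphisms. -/
def FreeGroup.permAut (α : Type*) : Equiv.Perm α →* MulAut (FreeGroup α) where
  toFun e := FreeGroup.freeGroupCongr e
  map_one' := FreeGroup.freeGroupCongr_refl
  map_mul' e e' := (FreeGroup.freeGroupCongr_trans e' e).symm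

/-- The homomorphism from the free group on `x, y` to `F_{m+1} ⋊ Perm` sending `x` to a basis
element and `y` to the cyclic permutation of the basis. -/
def cyclicShift (m : ℕ) : FreeGroup (Fin 2) →*
    FreeGroup (Fin (m + 1)) ⋊[FreeGroup.permAut (Fin (m + 1))] Equiv.Perm (Fin (m + 1)) :=
  FreeGroup.lift ![SemidirectProduct.inl (FreeGroup.of 0),
    SemidirectProduct.inr (Equiv.addRight 1)]

theorem cyclicShift_conj (m : ℕ) (i : Fin (m + 1)) :
    cyclicShift m
        (FreeGroup.of 1 ^ (i : ℕ) * FreeGroup.of 0 * (FreeGroup.of 1 ^ (i : ℕ))⁻¹) =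
      SemidirectProduct.inl (FreeGroup.of i) := by
  have h : (i : ℕ) • (1 : Fin (m + 1)) = i := by
    induction i using Fin.induction with
    | zero => simp
    | succ j ih => rw [Fin.val_succ, succ_nsmul, ← Fin.val_castSucc, ih, Fin.coeSucc_eq_succ]
  rw [map_mul, map_mul, map_inv, map_pow]
  simp only [cyclicShift, FreeGroup.lift_apply_of, Matrix.cons_val_zero, Matrix.cons_val_one]
  rw [← map_pow, ← map_inv, ← SemidirectProduct.inl_aut]
  simp [FreeGroup.permAut, h]

end CyclicShift

/-! ### Passage to Out(F₃) and conclusion. -/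

/-- A section of `twistedRep` over the Sanov subgroup, by squares of Nielsen transformations. -/
def nielsenLift : FreeGroup (Fin 2) →* signStabilizer :=
  FreeGroup.lift fun i => nielsenGen i ^ 2

theorem twistedRep_nielsenLift (w : FreeGroup (Fin 2)) :
    twistedRep (nielsenLift w) = sanov w := by
  have h : twistedRep.comp nielsenLift = sanov := by
    ext1 i
    simp [nielsenLift, sanov, twistedRep_nielsenGen_sq, -map_pow]
  exact DFunLike.congr_fun h w

/-- The natural map from `signStabilizer` to `Out(F₃)`. -/
def signStabilizerToOut : signStabilizer →* Out (FreeGroup (Fin 3)) :=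
  (QuotientGroup.mk' (Inn (FreeGroup (Fin 3)))).comp signStabilizer.subtype

instance finiteIndex_range_signStabilizerToOut : signStabilizerToOut.range.FiniteIndex := by
  have : (QuotientGroup.mk' (Inn (FreeGroup (Fin 3)))).range.FiniteIndex := by
    rw [QuotientGroup.range_mk']
    infer_instance
  rw [signStabilizerToOut, MonoidHom.range_comp, Subgroup.range_subtype]
  exact Subgroup.finiteIndex_map_of_range _ _

theorem twistedRep_sq_eq_one (φ : signStabilizer) (h : signStabilizerToOut φ = 1) :
    twistedRep (φ ^ 2) = 1 := by
  obtain ⟨x, hx⟩ := (QuotientGroup.eq_one_iff _).1 h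
  rw [map_pow, ← twistedRep_conj_sq x]
  exact congrArg (fun ψ => twistedRep ψ ^ 2) (Subtype.ext hx.symm)

theorem signStabilizerToOut_nielsenLift_mem (w : FreeGroup (Fin 2)) :
    signStabilizerToOut (nielsenLift (w * FreeGroup.of 0 * w⁻¹)) ∈ nielsenConjPowers (Fin 3) := by
  refine ⟨2, 1, by decide, signStabilizerToOut (nielsenLift w), 2, ?_⟩
  rw [conj_zpow, map_mul, map_mul, map_mul, map_mul, map_inv, map_inv, nielsenLift,
    FreeGroup.lift_apply_of, map_pow, ← zpow_natCast]
  rfl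

theorem proposition6p1 (k : ℕ) (hk : 1 ≤ k) :
    ∃ (H : Subgroup (Out (FreeGroup (Fin 3)))) (π : H →* FreeGroup (Fin k)),
      H.FiniteIndex ∧ Function.Surjective π ∧
      π.range =
        Subgroup.closure (π '' {h : H | (h : Out (FreeGroup (Fin 3))) ∈ nielsenConjPowers (Fin 3)}) := by
  obtain ⟨m, rfl⟩ := Nat.exists_eq_add_of_le' hk
  set U := (SemidirectProduct.rightHom.comp (cyclicShift m)).ker
  set P := (U.map sanov).comap twistedRep
  set q : P →* FreeGroup (Fin (m + 1)) :=
    pullbackAlong (SemidirectProduct.leftOnKer (cyclicShift m)) sanov sanov_injective twistedRep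
  have := finiteIndex_range_sanov
  have : (U.map sanov).FiniteIndex := Subgroup.finiteIndex_map_of_range _ _
  have : P.FiniteIndex := Subgroup.finiteIndex_comap _ _
  obtain ⟨π, hπ⟩ := exists_descent signStabilizerToOut P q fun x hx => by
    -- An inner x may act as -1, so only x² is known to act trivially; torsion-freeness then kills
    -- `q x`.
    have h := pullbackAlong_apply (SemidirectProduct.leftOnKer (cyclicShift m)) sanov
      sanov_injective twistedRep (x ^ 2) 1
      (by simpa using twistedRep_sq_eq_one x hx)
    rw [map_pow, map_one] at h
    exact (pow_eq_one_iff.1 h).resolve_right two_ne_zero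
  have hgen : ∀ i, FreeGroup.of i ∈
      π '' {h | (h : Out (FreeGroup (Fin 3))) ∈ nielsenConjPowers (Fin 3)} := fun i => by
    set w : FreeGroup (Fin 2) :=
      FreeGroup.of 1 ^ (i : ℕ) * FreeGroup.of 0 * (FreeGroup.of 1 ^ (i : ℕ))⁻¹
    have hw : cyclicShift m w = SemidirectProduct.inl (FreeGroup.of i) := cyclicShift_conj m i
    have hU : w ∈ U := by simp [U, MonoidHom.mem_ker, hw]
    have hP : nielsenLift w ∈ P := ⟨w, hU, (twistedRep_nielsenLift w).symm⟩
    refine ⟨signStabilizerToOut.subgroupMap P ⟨_, hP⟩, signStabilizerToOut_nielsenLift_mem _, ?_⟩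
    rw [hπ]
    refine (pullbackAlong_apply _ _ _ _ _ ⟨w, hU⟩ (twistedRep_nielsenLift w)).trans ?_
    exact congrArg SemidirectProduct.left hw
  have htop : Subgroup.closure
      (π '' {h | (h : Out (FreeGroup (Fin 3))) ∈ nielsenConjPowers (Fin 3)}) = ⊤ := by
    rw [eq_top_iff, ← FreeGroup.closure_range_of, Subgroup.closure_le]
    rintro _ ⟨i, rfl⟩
    exact Subgroup.subset_closure (hgen i)
  have hrange : π.range = ⊤ := by
    rw [eq_top_iff, ← htop, Subgroup.closure_le]
    exact (Set.image_subset_range _ _).trans_eq π.coe_range.symm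
  exact ⟨P.map signStabilizerToOut, π, Subgroup.finiteIndex_map_of_range _ _,
    MonoidHom.range_eq_top.1 hrange, hrange.trans htop.symm⟩
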